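/- Let $G$ be a compact connected Lie group with Lie algebra $\mathfrak g$ of left-invariant vector fields, and let $X_1,\dots,X_m\in\mathfrak g$ generate $\mathfrak g$ as a Lie algebra. A trajectory of the system $$x'=\sum_{k=1}^m u_k X_k(x)\qquad(\ast)$$ is a tuple $(x,u_1,\dots,u_m)$ where $u_1,\dots,u_m:\mathbb R\to\mathbb R$ are $C^\infty$ and $x:\mathbb R\to G$ is an integral curve of the time-dependent vector field $(t,y)\mapsto\sum_k u_k(t)X_k(y)$. It is periodic if, for some $T>0$, the functions $x,u_1,\dots,u_m$ are all $T$-periodic, and regular if $\operatorname{span}\{\operatorname{Ad}(x(t))X_k : t\in\mathbb R,\ 1\le k\le m\}=\mathfrak g$. Let $(x_r,u_1^r,\dots,u_m^r)$ be a regular periodic trajectory of $(\ast)$. Put $V(w)=\operatorname{tr}\operatorname{Ad}(w)$ for $w\in G$, and for $t\in\mathbb R$, $w\in G$ put $$a_k(t,w)=\mathrm dV\big((\operatorname{Ad}(x_r(t))X_k)(w)\big),\qquad W(t,w)=\sum_{k=1}^m a_k(t,w)\,(\operatorname{Ad}(x_r(t))X_k)(w)\in T_wG .$$ Let $\mathcal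 C_W=\{w\in G : W(t,w)=0\ \text{for all } t\in\mathbb R\}$. Then for all $x,y\in G$: 1. if $x\in\mathcal C_W$ then $yxy^{-1}\in\mathcal C_W$; 2. if $xy\in\mathcal C_W$ then $yx\in\mathcal C_W$; 3. if $x\in\mathcal C_W$ then $x^{-1}\in\mathcal C_W$. Moreover, if $G$ is semisimple (that is, $\mathfrak g$ has no nonzero solvable ideal) and $\mathcal C_W$ is a subgroup of $G$, then $\mathcal C_W$ is finite. -/

import Mathlib

open scoped Manifold ContDiff

noncomputable section

/-- A smooth real Lie group is of class `C^3`, the smoothness under which Mathlib builds the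
Lie bracket on its Lie algebra. -/
instance smoothLieGroup_minSmoothness
    {E : Type*} [NormedAddCommGroup E] [NormedSpace ℝ E] {H : Type*} [TopologicalSpace H]
    {I : ModelWithCorners ℝ E H} {G : Type*} [TopologicalSpace G] [ChartedSpace H G] [Group G]
    [LieGroup I ∞ G] : LieGroup I (minSmoothness ℝ 3) G :=
  LieGroup.of_le (n := ∞) (by
    rw [minSmoothness_of_isRCLikeNormedField]
    exact ENat.LEInfty.out)

namespace LieTracking

variable {E : Type*} [NormedAddCommGroup E] [NormedSpace ℝ E] {H : Type*} [TopologicalSpace H]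
  (I : ModelWithCorners ℝ E H)
  {G : Type*} [TopologicalSpace G] [ChartedSpace H G] [Group G]

/-- The adjoint representation: `Ad I x : 𝔤 → 𝔤` is the differential at the identity of the
conjugation `y ↦ x * y * x⁻¹`, where `𝔤 = T₁G`. (The differential takes its values in the tangent
space at `x * 1 * x⁻¹ = 1`.) -/
def Ad (x : G) : GroupLieAlgebra I G →ₗ[ℝ] GroupLieAlgebra I G :=
  (mfderiv I I (fun y : G => x * y * x⁻¹) (1 : G)).toLinearMap

/-- The Lyapunov-like function `V(x) = tr Ad(x)`. -/
def V (x : G) : ℝ := LinearMap.trace ℝ (GroupLieAlgebra I G) (Ad I x)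

/-- The time-dependent vector field `(t, x) ↦ ∑ k, u_k(t) X_k(x)` of the left-invariant driftless
system with controls `u`. Left-invariant vector fields are given by their values at `1`. -/
def controlField {m : ℕ} (X : Fin m → GroupLieAlgebra I G) (u : Fin m → ℝ → ℝ)
    (t : ℝ) (x : G) : TangentSpace I x :=
  ∑ k, u k t • (mulInvariantVectorField (X k) x : TangentSpace I x)

/-- `(x, u_1, …, u_m)` is a (smooth) trajectory of `x' = ∑ k, u_k X_k(x)`: the controls are smooth
functions on `ℝ` and `x : ℝ → G` is an integral curve of the associated time-dependent field. -/
structure IsTrajectory {m : ℕ} (X : Fin m → GroupLieAlgebra I G) (x : ℝ → G)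
    (u : Fin m → ℝ → ℝ) : Prop where
  smooth_controls : ∀ k, ContDiff ℝ ∞ (u k)
  integralCurve : ∀ t : ℝ, HasMFDerivAt 𝓘(ℝ, ℝ) I x t
    ((1 : ℝ →L[ℝ] ℝ).smulRight (controlField I X u t (x t)))

/-- A trajectory is `T`-periodic if `T > 0` and the curve and all the controls are `T`-periodic. -/
structure IsPeriodicTrajectory {m : ℕ} (X : Fin m → GroupLieAlgebra I G) (x : ℝ → G)
    (u : Fin m → ℝ → ℝ) (T : ℝ) : Prop extends IsTrajectory I X x u where
  period_pos : 0 < T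
  periodic_curve : Function.Periodic x T
  periodic_controls : ∀ k, Function.Periodic (u k) T

/-- Regularity of a trajectory with underlying curve `x`: the vectors `Ad(x(t)) X_k` span `𝔤`. -/
def IsRegularTrajectory {m : ℕ} (X : Fin m → GroupLieAlgebra I G) (x : ℝ → G) : Prop :=
  Submodule.span ℝ {Y : GroupLieAlgebra I G | ∃ (t : ℝ) (k : Fin m), Y = Ad I (x t) (X k)} = ⊤

/-- The functions `a_k(t, w) = dV (Ad(x_r(t)) X_k (w))`. -/
def auxCoeff {m : ℕ} (X : Fin m → GroupLieAlgebra I G) (xr : ℝ → G)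
    (k : Fin m) (t : ℝ) (w : G) : ℝ :=
  mfderiv I 𝓘(ℝ, ℝ) (V I : G → ℝ) w (mulInvariantVectorField (Ad I (xr t) (X k)) w)

/-- The auxiliary vector field `W(t, w) = ∑ k, a_k(t, w) Ad(x_r(t)) X_k (w)`. -/
def auxField {m : ℕ} (X : Fin m → GroupLieAlgebra I G) (xr : ℝ → G)
    (t : ℝ) (w : G) : TangentSpace I w :=
  ∑ k, auxCoeff I X xr k t w •
    (mulInvariantVectorField (Ad I (xr t) (X k)) w : TangentSpace I w)

/-- The set `C_W` of critical points of the auxiliary vector field. -/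
def criticalSet {m : ℕ} (X : Fin m → GroupLieAlgebra I G) (xr : ℝ → G) : Set G :=
  {w : G | ∀ t : ℝ, auxField I X xr t w = 0}

end LieTracking

end

/-!
Applying `dV` to `W(t, w)` gives `∑ k, a_k(t, w) ^ 2`, so `W(t, w) = 0` forces every `a_k(t, w)` to
vanish; since the vectors `Ad(x_r(t)) X_k` span `𝔤`, the set `C_W` is exactly the critical set of
`V = tr Ad`. This function is invariant under conjugation, and also under inversion: by compactness
`Ad` preserves an inner product, for which `Ad(x⁻¹)` is the adjoint of `Ad(x)`. Its critical set
inherits both symmetries.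

In the left trivialization, `dV` at `g` is the linear form `z ↦ tr (Ad g ∘ ad z)`. The derivative of
this form at `g = 1` in the direction `v` is `z ↦ tr (ad v ∘ ad z)`, the Killing form paired with
`v`. For semisimple `𝔤` the Killing form is nondegenerate, so `1` is an isolated critical point, and
a subgroup of a compact group in which `1` is isolated is finite.
-/

open Filter Topology MeasureTheory

section Calculus

variable {𝕜 : Type*} [NontriviallyNormedField 𝕜]
  {E : Type*} [NormedAddCommGroup E] [NormedSpace 𝕜 E]
  {F : Type*} [NormedAddCommGroup F] [NormedSpace 𝕜 F]
  {F' : Type*} [NormedAddCommGroup F'] [NormedSpace 𝕜 F']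

theorem fderiv_fderiv_comm {f : E × F → F'} {x : E} {y : F} {n : WithTop ℕ∞}
    (hf : ContDiffAt 𝕜 n f (x, y)) (hn : minSmoothness 𝕜 2 ≤ n) (u : E) (v : F) :
    fderiv 𝕜 (fun b => fderiv 𝕜 (fun a => f (a, b)) x) y v u =
      fderiv 𝕜 (fun a => fderiv 𝕜 (fun b => f (a, b)) y) x u v := by
  have hf2 : ContDiffAt 𝕜 2 f (x, y) := hf.of_le (le_minSmoothness.trans hn)
  have hf' : HasFDerivAt (fderiv 𝕜 f) (fderiv 𝕜 (fderiv 𝕜 f) (x, y)) (x, y) :=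
    ((hf2.fderiv_right (m := 1) one_add_one_eq_two.le).differentiableAt one_ne_zero).hasFDerivAt
  have hdiff : ∀ᶠ p in 𝓝 (x, y), DifferentiableAt 𝕜 f p :=
    (hf2.eventually (by simp)).mono fun p hp => hp.differentiableAt two_ne_zero
  have hleft : (fun b => fderiv 𝕜 (fun a => f (a, b)) x) =ᶠ[𝓝 y]
      fun b => (fderiv 𝕜 f (x, b)).comp (.inl 𝕜 E F) := by
    filter_upwards [(Continuous.prodMk_right x).continuousAt.eventually hdiff] with b hb
    exact (hb.hasFDerivAt.comp x (hasFDerivAt_prodMk_left x b)).fderiv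
  have hright : (fun a => fderiv 𝕜 (fun b => f (a, b)) y) =ᶠ[𝓝 x]
      fun a => (fderiv 𝕜 f (a, y)).comp (.inr 𝕜 E F) := by
    filter_upwards [(Continuous.prodMk_left y).continuousAt.eventually hdiff] with a ha
    exact (ha.hasFDerivAt.comp y (hasFDerivAt_prodMk_right a y)).fderiv
  have hleft' : HasFDerivAt (fun b => (fderiv 𝕜 f (x, b)).comp (.inl 𝕜 E F)) _ y :=
    (hf'.comp y (hasFDerivAt_prodMk_right x y)).clm_comp
      (hasFDerivAt_const (ContinuousLinearMap.inl 𝕜 E F) y)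
  have hright' : HasFDerivAt (fun a => (fderiv 𝕜 f (a, y)).comp (.inr 𝕜 E F)) _ x :=
    (hf'.comp x (hasFDerivAt_prodMk_left x y)).clm_comp
      (hasFDerivAt_const (ContinuousLinearMap.inr 𝕜 E F) x)
  rw [hleft.fderiv_eq, hright.fderiv_eq, hleft'.fderiv, hright'.fderiv]
  simpa using hf.isSymmSndFDerivAt hn (0, v) (u, 0)

/- Differentiating `R a ∘ A a = L a` at `e`, where `L a` and `R a` are the differentials at `e` of
the left and right translations by `a`, gives `R' v w + A' v w = L' v w`; the symmetry of the second
derivative of `m` turns `R' v w` into `L' w v`. -/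
theorem fderiv_eq_lieBracket_of_local_mul {m : E × E → E} {A : E → E →L[𝕜] E} {e : E}
    {n : WithTop ℕ∞} (hm : ContDiffAt 𝕜 n m (e, e)) (hn : minSmoothness 𝕜 2 ≤ n)
    (mul_one : ∀ᶠ a in 𝓝 e, m (a, e) = a) (one_mul : ∀ᶠ a in 𝓝 e, m (e, a) = a)
    (hA : DifferentiableAt 𝕜 A e)
    (hconj : ∀ᶠ a in 𝓝 e, (fderiv 𝕜 (fun b => m (b, a)) e).comp (A a) =
      fderiv 𝕜 (fun b => m (a, b)) e) (v w : E) :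
    fderiv 𝕜 A e v w = VectorField.lieBracket 𝕜 (fun a => fderiv 𝕜 (fun b => m (a, b)) e v)
      (fun a => fderiv 𝕜 (fun b => m (a, b)) e w) e := by
  set L : E → E →L[𝕜] E := fun a => fderiv 𝕜 (fun b => m (a, b)) e
  set R : E → E →L[𝕜] E := fun a => fderiv 𝕜 (fun b => m (b, a)) e
  have hm2 : ContDiffAt 𝕜 2 m (e, e) := hm.of_le (le_minSmoothness.trans hn)
  have hL : DifferentiableAt 𝕜 L e :=
    (ContDiffAt.fderiv (m := 1) (f := fun a b => m (a, b)) (g := fun _ => e) hm2 contDiffAt_const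
      one_add_one_eq_two.le).differentiableAt one_ne_zero
  have hR : DifferentiableAt 𝕜 R e :=
    (ContDiffAt.fderiv (m := 1) (f := fun a b => m (b, a)) (g := fun _ => e)
      (hm2.comp (e, e) (contDiff_snd.prodMk contDiff_fst).contDiffAt) contDiffAt_const
      one_add_one_eq_two.le).differentiableAt one_ne_zero
  have L_one : L e = .id 𝕜 E := (EventuallyEq.fderiv_eq one_mul).trans fderiv_fun_id
  have R_one : R e = .id 𝕜 E := (EventuallyEq.fderiv_eq mul_one).trans fderiv_fun_id
  have A_one : A e = .id 𝕜 E := by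
    have h : (R e).comp (A e) = L e := hconj.self_of_nhds
    rwa [R_one, L_one, ContinuousLinearMap.id_comp] at h
  have hprod : fderiv 𝕜 R e v w + fderiv 𝕜 A e v w = fderiv 𝕜 L e v w := by
    have h := (hR.hasFDerivAt.clm_comp hA.hasFDerivAt).unique
      (hL.hasFDerivAt.congr_of_eventuallyEq hconj)
    rw [← h]
    simp [A_one, R_one, add_comm]
  have hswap : fderiv 𝕜 R e v w = fderiv 𝕜 L e w v := fderiv_fderiv_comm hm hn w v
  have hfield (u : E) : fderiv 𝕜 (fun a => L a u) e = (fderiv 𝕜 L e).flip u := by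
    simp [fderiv_clm_apply hL (differentiableAt_const u)]
  calc fderiv 𝕜 A e v w = fderiv 𝕜 L e v w - fderiv 𝕜 L e w v := by
        rw [← hprod, hswap, add_sub_cancel_left]
    _ = VectorField.lieBracket 𝕜 (fun a => L a v) (fun a => L a w) e := by
        simp [VectorField.lieBracket, hfield, L_one]

end Calculus

section CompactGroup

theorem trace_eq_of_isAdjointPair {K V : Type*} [Field K] [AddCommGroup V] [Module K V]
    [FiniteDimensional K V] {B : LinearMap.BilinForm K V} (hB : B.Nondegenerate)
    {f g : V →ₗ[K] V} (h : LinearMap.IsAdjointPair B B f g) :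
    LinearMap.trace K V f = LinearMap.trace K V g := by
  have hconj : (B.toDual hB).conj f = Module.Dual.transpose (R := K) g := by
    ext φ v
    obtain ⟨u, rfl⟩ := (B.toDual hB).surjective φ
    simpa [LinearEquiv.conj_apply, Module.Dual.transpose_apply,
      LinearMap.BilinForm.toDual_def] using h u v
  rw [← LinearMap.trace_conj' f (B.toDual hB), hconj, LinearMap.trace_transpose']

variable {G : Type*} [Group G] [TopologicalSpace G] [IsTopologicalGroup G] [CompactSpace G]
  {E : Type*} [NormedAddCommGroup E] [NormedSpace ℝ E] [FiniteDimensional ℝ E]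

theorem exists_invariant_bilinForm_of_continuous {ρ : G →* (E →L[ℝ] E)} (hρ : Continuous ρ) :
    ∃ B : LinearMap.BilinForm ℝ E, (∀ u, u ≠ 0 → 0 < B u u) ∧
      ∀ g u v, B (ρ g u) (ρ g v) = B u v := by
  borelize G
  let μ : Measure G := .haar
  let β (u v : E) (g : G) : ℝ := inner ℝ (toEuclidean (ρ g⁻¹ u)) (toEuclidean (ρ g⁻¹ v))
  have β_continuous (u v : E) : Continuous (β u v) := by fun_prop
  have β_integrable (u v : E) : Integrable (β u v) μ :=
    (β_continuous u v).integrable_of_hasCompactSupport (.of_compactSpace _)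
  let B : LinearMap.BilinForm ℝ E := LinearMap.mk₂ ℝ (fun u v => ∫ g, β u v g ∂μ)
    (fun u u' v => by
      rw [← integral_add (β_integrable u v) (β_integrable u' v)]
      simp only [β, map_add, inner_add_left])
    (fun c u v => by
      rw [smul_eq_mul, ← integral_const_mul]
      simp only [β, map_smul, real_inner_smul_left])
    (fun u v v' => by
      rw [← integral_add (β_integrable u v) (β_integrable u v')]
      simp only [β, map_add, inner_add_right])
    (fun c u v => by
      rw [smul_eq_mul, ← integral_const_mul]
      simp only [β, map_smul, real_inner_smul_right])
  refine ⟨B, fun u hu => ?_, fun g u v => ?_⟩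
  · refine (β_continuous u u).integral_pos_of_hasCompactSupport_nonneg_nonzero (x := 1)
      (.of_compactSpace _) (fun g => real_inner_self_nonneg) ?_
    simpa [β] using hu
  · calc B (ρ g u) (ρ g v) = ∫ h, β u v (g⁻¹ * h) ∂μ := by simp [B, β]
      _ = B u v := integral_mul_left_eq_self _ _

theorem trace_map_inv_of_continuous {ρ : G →* (E →L[ℝ] E)} (hρ : Continuous ρ) (g : G) :
    LinearMap.trace ℝ E (ρ g⁻¹) = LinearMap.trace ℝ E (ρ g) := by
  obtain ⟨B, B_pos, B_inv⟩ := exists_invariant_bilinForm_of_continuous hρ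
  have B_ne {u : E} (hu : u ≠ 0) : B u u ≠ 0 := (B_pos u hu).ne'
  have hB : B.Nondegenerate :=
    ⟨fun u hu => by_contra fun h => B_ne h (hu u), fun u hu => by_contra fun h => B_ne h (hu u)⟩
  refine trace_eq_of_isAdjointPair hB fun u v => ?_
  have h : ρ g (ρ g⁻¹ u) = u := by rw [← mul_apply_eq_comp, ← map_mul]; simp
  calc B (ρ g⁻¹ u) v = B (ρ g (ρ g⁻¹ u)) (ρ g v) := (B_inv g _ _).symm
    _ = B u (ρ g v) := by rw [h]

end CompactGroup

theorem subgroup_finite_of_eventually_eq_one {G : Type*} [Group G] [TopologicalSpace G]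
    [IsTopologicalGroup G] [CompactSpace G] {K : Subgroup G}
    (hK : ∀ᶠ g in 𝓝 (1 : G), g ∈ K → g = 1) : (K : Set G).Finite := by
  obtain ⟨U, hU, hUK⟩ := exists_nhds_split_inv hK
  have mem_nhds (x : G) : {k | k / x ∈ U} ∈ 𝓝 x :=
    (continuous_id.div_const x).continuousAt.preimage_mem_nhds (by simpa using hU)
  obtain ⟨t, ht⟩ := CompactSpace.elim_nhds_subcover _ mem_nhds
  have inter_subsingleton (x : G) : ((K : Set G) ∩ {k | k / x ∈ U}).Subsingleton := by
    rintro k ⟨hk, hkx⟩ l ⟨hl, hlx⟩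
    have h := hUK _ hkx _ hlx
    rw [div_div_div_cancel_right] at h
    exact div_eq_one.1 (h (K.div_mem hk hl))
  refine (t.finite_toSet.biUnion fun x _ => (inter_subsingleton x).finite).subset fun k hk => ?_
  simpa [hk] using ht.ge (Set.mem_univ k)

theorem inTangentCoordinates_apply_of_eq {𝕜 : Type*} [NontriviallyNormedField 𝕜]
    {E E' : Type*} [NormedAddCommGroup E] [NormedSpace 𝕜 E] [NormedAddCommGroup E']
    [NormedSpace 𝕜 E'] {H H' : Type*} [TopologicalSpace H] [TopologicalSpace H']
    {I : ModelWithCorners 𝕜 E H} {I' : ModelWithCorners 𝕜 E' H'}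
    {M M' N : Type*} [TopologicalSpace M] [ChartedSpace H M] [IsManifold I 1 M]
    [TopologicalSpace M'] [ChartedSpace H' M'] [IsManifold I' 1 M']
    {f : N → M} {g : N → M'} (A : N → E →L[𝕜] E') {x₀ x : N} (hf : f x = f x₀)
    (hg : g x = g x₀) : inTangentCoordinates I I' f g A x₀ x = A x := by
  rw [inTangentCoordinates_eq f g A (by simp [hf]) (by simp [hg]), hf, hg]
  ext v
  simp only [ContinuousLinearMap.comp_apply]
  rw [VectorBundleCore.coordChange_self, VectorBundleCore.coordChange_self]
  · exact mem_chart_source H (f x₀)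
  · exact mem_chart_source H' (g x₀)

theorem hasFDerivAt_comp_extChartAt_symm {𝕜 : Type*} [NontriviallyNormedField 𝕜]
    {E F : Type*} [NormedAddCommGroup E] [NormedSpace 𝕜 E] [NormedAddCommGroup F]
    [NormedSpace 𝕜 F] {H : Type*} [TopologicalSpace H] {I : ModelWithCorners 𝕜 E H}
    [I.Boundaryless] {M : Type*} [TopologicalSpace M] [ChartedSpace H M]
    {f : M → F} {f' : E →L[𝕜] F} {x : M} (hf : HasMFDerivAt I 𝓘(𝕜, F) f x f') :
    HasFDerivAt (f ∘ (extChartAt I x).symm) f' (extChartAt I x x) := by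
  have h := hf.2
  rw [I.range_eq_univ] at h
  exact hasFDerivWithinAt_univ.1 h

theorem mfderiv_eq_zero_of_comp_eq {𝕜 : Type*} [NontriviallyNormedField 𝕜]
    {E F : Type*} [NormedAddCommGroup E] [NormedSpace 𝕜 E] [NormedAddCommGroup F]
    [NormedSpace 𝕜 F] {H : Type*} [TopologicalSpace H] {I : ModelWithCorners 𝕜 E H}
    {M : Type*} [TopologicalSpace M] [ChartedSpace H M] {f : M → F} {φ : M → M} {x : M}
    (hf : MDifferentiableAt I 𝓘(𝕜, F) f (φ x)) (hφ : MDifferentiableAt I I φ x)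
    (hfφ : f ∘ φ = f) (h : mfderiv I 𝓘(𝕜, F) f (φ x) = 0) : mfderiv I 𝓘(𝕜, F) f x = 0 := by
  have hcomp := mfderiv_comp x hf hφ
  rw [h, hfφ] at hcomp
  exact hcomp.trans (ContinuousLinearMap.zero_comp _)

/-- The trace on the continuous endomorphisms of a finite-dimensional space, as a continuous linear
form, so that it can be differentiated and composed with differentials. -/
noncomputable def traceCLM (𝕜 : Type*) [NontriviallyNormedField 𝕜] [CompleteSpace 𝕜] (E : Type*)
    [NormedAddCommGroup E] [NormedSpace 𝕜 E] [FiniteDimensional 𝕜 E] : (E →L[𝕜] E) →L[𝕜] 𝕜 :=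
  (LinearMap.trace 𝕜 E ∘ₗ ContinuousLinearMap.coeLM 𝕜).toContinuousLinearMap

noncomputable section

namespace LieTracking

variable {E : Type*} [NormedAddCommGroup E] [NormedSpace ℝ E] {H : Type*} [TopologicalSpace H]
  (I : ModelWithCorners ℝ E H)
  {G : Type*} [TopologicalSpace G] [ChartedSpace H G] [Group G]

theorem mfderiv_V_auxField {m : ℕ} (X : Fin m → GroupLieAlgebra I G) (xr : ℝ → G) (t : ℝ)
    (w : G) : mfderiv I 𝓘(ℝ, ℝ) (V I) w (auxField I X xr t w) =
      ∑ k, auxCoeff I X xr k t w ^ 2 := by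
  rw [auxField]
  refine (map_sum (mfderiv I 𝓘(ℝ, ℝ) (V I) w) _ _).trans (Finset.sum_congr rfl fun k _ => ?_)
  rw [pow_two]
  exact map_smul (mfderiv I 𝓘(ℝ, ℝ) (V I) w) _ _

theorem auxField_eq_zero_iff {m : ℕ} {X : Fin m → GroupLieAlgebra I G} {xr : ℝ → G} {t : ℝ}
    {w : G} : auxField I X xr t w = 0 ↔ ∀ k, auxCoeff I X xr k t w = 0 := by
  refine ⟨fun h k => ?_, fun h => ?_⟩
  · have hsum := mfderiv_V_auxField I X xr t w
    rw [h] at hsum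
    have hsum' : ∑ k, auxCoeff I X xr k t w ^ 2 = 0 := hsum.symm.trans (map_zero _)
    rw [Finset.sum_eq_zero_iff_of_nonneg fun k _ => sq_nonneg _] at hsum'
    exact pow_eq_zero_iff two_ne_zero |>.1 (hsum' k (Finset.mem_univ k))
  · exact Finset.sum_eq_zero fun k _ => by rw [h k, zero_smul]

/-- The group law read in the preferred chart at the identity. -/
def chartMul (G : Type*) [TopologicalSpace G] [ChartedSpace H G] [Group G] (p : E × E) : E :=
  extChartAt I (1 : G) ((extChartAt I (1 : G)).symm p.1 * (extChartAt I (1 : G)).symm p.2)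

theorem eventually_chartMul_one [I.Boundaryless] :
    ∀ᶠ a in 𝓝 (extChartAt I (1 : G) 1), chartMul I G (a, extChartAt I (1 : G) 1) = a := by
  filter_upwards [extChartAt_target_mem_nhds (I := I) (1 : G)] with a ha
  simpa [chartMul] using (extChartAt I (1 : G)).right_inv ha

theorem eventually_one_chartMul [I.Boundaryless] :
    ∀ᶠ a in 𝓝 (extChartAt I (1 : G) 1), chartMul I G (extChartAt I (1 : G) 1, a) = a := by
  filter_upwards [extChartAt_target_mem_nhds (I := I) (1 : G)] with a ha
  simpa [chartMul] using (extChartAt I (1 : G)).right_inv ha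

variable [LieGroup I ∞ G]

theorem contMDiff_conj : ContMDiff (I.prod I) I ∞ fun p : G × G => p.1 * p.2 * p.1⁻¹ :=
  (contMDiff_fst.mul contMDiff_snd).mul contMDiff_fst.inv

theorem contMDiff_conj_right (x : G) : ContMDiff I I ∞ fun y => x * y * x⁻¹ :=
  (contMDiff_const.mul contMDiff_id).mul contMDiff_const

/-- The adjoint representation with values in the normed algebra of operators on the model space
`E`, which is `𝔤 = T₁G` by definition; unlike `GroupLieAlgebra I G`, it carries a norm, so that
the smoothness of `Ad` makes sense. -/
def adjointRep : G →* (E →L[ℝ] E) where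
  toFun x := mfderiv I I (fun y : G => x * y * x⁻¹) 1
  map_one' := by
    have h : (fun y : G => 1 * y * 1⁻¹) = id := by
      funext y
      simp
    rw [h]
    exact mfderiv_id
  map_mul' x y := by
    have h : (fun z : G => x * y * z * (x * y)⁻¹) =
        (fun z => x * z * x⁻¹) ∘ fun z => y * z * y⁻¹ := by
      funext z
      simp [mul_assoc]
    have hconj (g : G) : MDifferentiable I I fun z : G => g * z * g⁻¹ :=
      (contMDiff_conj_right I g).mdifferentiable (by simp)
    rw [h]
    ext v
    exact mfderiv_comp_apply_of_eq (1 : G) (hconj x 1) (hconj y 1) (by simp) v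

theorem contMDiff_adjointRep : ContMDiff I 𝓘(ℝ, E →L[ℝ] E) ∞ (adjointRep I : G → E →L[ℝ] E) := by
  have : IsManifold I 1 G := .of_le (n := ∞) (by simp)
  intro x₀
  have h := ContMDiffAt.mfderiv (I := I) (I' := I) (m := ∞) (fun x y : G => x * y * x⁻¹)
    (fun _ : G => 1) (contMDiff_conj I (x₀, 1)) (contMDiffAt_const (x := x₀)) (by simp)
  refine h.congr_of_eventuallyEq (.of_forall fun x => Eq.symm ?_)
  exact inTangentCoordinates_apply_of_eq (adjointRep I) rfl (by simp)

theorem mfderiv_mul_right_comp_adjointRep (g : G) :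
    (mfderiv I I (fun y => y * g) 1 : E →L[ℝ] E).comp (adjointRep I g) =
      (mfderiv I I (fun y => g * y) 1 : E →L[ℝ] E) := by
  have h : (fun y => g * y) = (fun y => y * g) ∘ fun y => g * y * g⁻¹ := by
    funext y
    simp
  rw [h]
  ext v
  exact (mfderiv_comp_apply_of_eq (1 : G)
    ((contMDiff_mul_right (I := I) (n := ∞)).mdifferentiable (by simp) 1)
    ((contMDiff_conj_right I g).mdifferentiable (by simp) 1) (by simp) v).symm

/-- The adjoint representation of the Lie algebra, as the differential of `Ad` at the identity. -/
def ad (G : Type*) [TopologicalSpace G] [ChartedSpace H G] [Group G] [LieGroup I ∞ G] :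
    E →L[ℝ] E →L[ℝ] E :=
  mfderiv I 𝓘(ℝ, E →L[ℝ] E) (adjointRep I : G → E →L[ℝ] E) 1

theorem hasMFDerivAt_adjointRep_one :
    HasMFDerivAt I 𝓘(ℝ, E →L[ℝ] E) (adjointRep I : G → E →L[ℝ] E) 1
      (ad I G : E →L[ℝ] E →L[ℝ] E) :=
  ((contMDiff_adjointRep I).mdifferentiable (by simp) 1).hasMFDerivAt

section LieBracket

variable [I.Boundaryless]

theorem contDiffAt_chartMul :
    ContDiffAt ℝ ∞ (chartMul I G) (extChartAt I (1 : G) 1, extChartAt I (1 : G) 1) := by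
  have hsymm : ContMDiffAt 𝓘(ℝ, E) I ∞ (extChartAt I (1 : G)).symm (extChartAt I (1 : G) 1) :=
    (contMDiffOn_extChartAt_symm (1 : G)).contMDiffAt (extChartAt_target_mem_nhds (1 : G))
  have hfst := hsymm.comp (extChartAt I (1 : G) 1, extChartAt I (1 : G) 1)
    (contDiff_fst (E := E) (F := E)).contMDiff.contMDiffAt
  have hsnd := hsymm.comp (extChartAt I (1 : G) 1, extChartAt I (1 : G) 1)
    (contDiff_snd (E := E) (F := E)).contMDiff.contMDiffAt
  exact (ContMDiffAt.comp_of_eq (I' := I) (contMDiffAt_extChartAt (x := (1 : G)))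
    (hfst.mul hsnd) (by simp)).contDiffAt

theorem hasFDerivAt_extChartAt_comp_symm {f : G → G} {g : G} (hf : MDifferentiableAt I I f 1)
    (hfg : f 1 = g) (hg : g ∈ (extChartAt I (1 : G)).source) :
    HasFDerivAt (fun b => extChartAt I (1 : G) (f ((extChartAt I (1 : G)).symm b)))
      ((mfderiv I 𝓘(ℝ, E) (extChartAt I (1 : G)) g : E →L[ℝ] E).comp (mfderiv I I f 1))
      (extChartAt I (1 : G) 1) := by
  subst hfg
  rw [extChartAt_source] at hg
  exact hasFDerivAt_comp_extChartAt_symm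
    ((mdifferentiableAt_extChartAt hg).hasMFDerivAt.comp (1 : G) hf.hasMFDerivAt)

theorem fderiv_chartMul_right {a : E} (ha : a ∈ (extChartAt I (1 : G)).target) :
    fderiv ℝ (fun b => chartMul I G (a, b)) (extChartAt I (1 : G) 1) =
      (mfderiv I 𝓘(ℝ, E) (extChartAt I (1 : G)) ((extChartAt I (1 : G)).symm a) :
        E →L[ℝ] E).comp (mfderiv I I (fun y => (extChartAt I (1 : G)).symm a * y) 1) := by
  refine HasFDerivAt.fderiv (f := fun b => chartMul I G (a, b)) ?_
  exact hasFDerivAt_extChartAt_comp_symm I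
    ((contMDiff_mul_left (I := I) (n := ∞)).mdifferentiable (by simp) 1) (mul_one _)
    ((extChartAt I (1 : G)).map_target ha)

theorem fderiv_chartMul_left {a : E} (ha : a ∈ (extChartAt I (1 : G)).target) :
    fderiv ℝ (fun b => chartMul I G (b, a)) (extChartAt I (1 : G) 1) =
      (mfderiv I 𝓘(ℝ, E) (extChartAt I (1 : G)) ((extChartAt I (1 : G)).symm a) :
        E →L[ℝ] E).comp (mfderiv I I (fun y => y * (extChartAt I (1 : G)).symm a) 1) := by
  refine HasFDerivAt.fderiv (f := fun b => chartMul I G (b, a)) ?_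
  exact hasFDerivAt_extChartAt_comp_symm I
    ((contMDiff_mul_right (I := I) (n := ∞)).mdifferentiable (by simp) 1) (one_mul _)
    ((extChartAt I (1 : G)).map_target ha)

theorem fderiv_chartMul_left_comp_adjointRep {a : E} (ha : a ∈ (extChartAt I (1 : G)).target) :
    (fderiv ℝ (fun b => chartMul I G (b, a)) (extChartAt I (1 : G) 1)).comp
        (adjointRep I ((extChartAt I (1 : G)).symm a)) =
      fderiv ℝ (fun b => chartMul I G (a, b)) (extChartAt I (1 : G) 1) := by
  rw [fderiv_chartMul_left I ha, fderiv_chartMul_right I ha]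
  exact congrArg (ContinuousLinearMap.comp (mfderiv I 𝓘(ℝ, E) (extChartAt I (1 : G))
    ((extChartAt I (1 : G)).symm a) : E →L[ℝ] E)) (mfderiv_mul_right_comp_adjointRep I _)

theorem mpullbackWithin_mulInvariantVectorField (v : GroupLieAlgebra I G) {a : E}
    (ha : a ∈ (extChartAt I (1 : G)).target) :
    VectorField.mpullbackWithin 𝓘(ℝ, E) I (extChartAt I (1 : G)).symm
        (mulInvariantVectorField v) (Set.range I) a =
      fderiv ℝ (fun b => chartMul I G (a, b)) (extChartAt I (1 : G) 1) v := by
  have : IsManifold I 1 G := .of_le (n := ∞) (by simp)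
  rw [VectorField.mpullbackWithin_apply, ContinuousLinearMap.inverse_eq
    (mfderivWithin_extChartAt_symm_comp_mfderiv_extChartAt ha)
    (mfderiv_extChartAt_comp_mfderivWithin_extChartAt_symm ha), fderiv_chartMul_right I ha]
  rfl

theorem bracket_eq_lieBracket_chartMul (v w : GroupLieAlgebra I G) :
    ⁅v, w⁆ = VectorField.lieBracket ℝ
      (fun a => fderiv ℝ (fun b => chartMul I G (a, b)) (extChartAt I (1 : G) 1) v)
      (fun a => fderiv ℝ (fun b => chartMul I G (a, b)) (extChartAt I (1 : G) 1) w)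
      (extChartAt I (1 : G) 1) := by
  have pullback_eventuallyEq (u : GroupLieAlgebra I G) :
      VectorField.mpullbackWithin 𝓘(ℝ, E) I (extChartAt I (1 : G)).symm
        (mulInvariantVectorField u) Set.univ =ᶠ[𝓝 (extChartAt I (1 : G) 1)]
      fun a => fderiv ℝ (fun b => chartMul I G (a, b)) (extChartAt I (1 : G) 1) u := by
    filter_upwards [extChartAt_target_mem_nhds (I := I) (1 : G)] with a ha
    rw [← I.range_eq_univ, mpullbackWithin_mulInvariantVectorField I u ha]
  rw [GroupLieAlgebra.bracket_def, ← VectorField.mlieBracketWithin_univ,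
    VectorField.mlieBracketWithin_apply, mfderiv_extChartAt_self]
  refine (DFunLike.congr_fun (F := E →L[ℝ] E)
    (ContinuousLinearMap.inverse_id (R := ℝ) (M := E)) _).trans ?_
  rw [Set.preimage_univ, Set.univ_inter, I.range_eq_univ]
  exact (congrFun VectorField.lieBracketWithin_univ _).trans
    ((pullback_eventuallyEq v).lieBracket_vectorField_eq (pullback_eventuallyEq w))

theorem hasFDerivAt_adjointRep_extChartAt_symm :
    HasFDerivAt (fun a => adjointRep I ((extChartAt I (1 : G)).symm a)) (ad I G)
      (extChartAt I (1 : G) 1) :=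
  hasFDerivAt_comp_extChartAt_symm (hasMFDerivAt_adjointRep_one I)

theorem ad_apply_apply (v w : GroupLieAlgebra I G) : ad I G v w = ⁅v, w⁆ := by
  have hdAd := hasFDerivAt_adjointRep_extChartAt_symm I (G := G)
  have hconj : ∀ᶠ a in 𝓝 (extChartAt I (1 : G) 1), _ := eventually_of_mem
    (extChartAt_target_mem_nhds (I := I) (1 : G)) fun a => fderiv_chartMul_left_comp_adjointRep I
  rw [bracket_eq_lieBracket_chartMul]
  refine Eq.trans ?_ (fderiv_eq_lieBracket_of_local_mul (contDiffAt_chartMul I)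
    (by simpa using ENat.LEInfty.out)
    (eventually_chartMul_one I) (eventually_one_chartMul I) hdAd.differentiableAt hconj v w)
  rw [hdAd.fderiv]

end LieBracket

theorem V_eq_trace_adjointRep (w : G) : V I w = LinearMap.trace ℝ E (adjointRep I w) :=
  rfl

theorem V_mul_comm (x y : G) : V I (x * y) = V I (y * x) := by
  simp only [V_eq_trace_adjointRep, map_mul]
  exact LinearMap.trace_mul_comm ℝ _ _

theorem V_comp_conj (y : G) : V I ∘ (fun x => y * x * y⁻¹) = V I := by
  funext x
  rw [Function.comp_apply, V_mul_comm, inv_mul_cancel_left]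

theorem exists_mulInvariantVectorField_eq (w : G) (u : TangentSpace I w) :
    ∃ v : GroupLieAlgebra I G, mulInvariantVectorField v w = u := by
  have hmul (g : G) : MDifferentiable I I fun z : G => g * z :=
    (contMDiff_mul_left (I := I) (n := ∞)).mdifferentiable (by simp)
  have hid : (fun z : G => w * z) ∘ (fun z => w⁻¹ * z) = id := by
    funext z
    simp
  refine ⟨mfderiv I I (fun z => w⁻¹ * z) w u, ?_⟩
  have h := mfderiv_comp_apply_of_eq w (hmul w 1) (hmul w⁻¹ w) (inv_mul_cancel w) u
  rw [hid, mfderiv_id] at h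
  exact h.symm

theorem mem_criticalSet_iff {m : ℕ} {X : Fin m → GroupLieAlgebra I G} {xr : ℝ → G}
    (hreg : IsRegularTrajectory I X xr) {w : G} :
    w ∈ criticalSet I X xr ↔ mfderiv I 𝓘(ℝ, ℝ) (V I) w = 0 := by
  simp only [criticalSet, Set.mem_ofPred_eq, auxField_eq_zero_iff]
  refine ⟨fun h => ?_, fun h t k => ?_⟩
  · let f : GroupLieAlgebra I G →ₗ[ℝ] ℝ :=
      (mfderiv I 𝓘(ℝ, ℝ) (V I) w ∘L mfderiv I I (w * ·) (1 : G) : _ →L[ℝ] ℝ)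
    have hle : ⊤ ≤ LinearMap.ker f := by
      rw [← show _ = _ from hreg, Submodule.span_le]
      rintro _ ⟨t, k, rfl⟩
      exact h t k
    ext u
    obtain ⟨v, rfl⟩ := exists_mulInvariantVectorField_eq I w u
    exact hle (x := v) trivial
  · rw [auxCoeff, h]
    rfl

variable [FiniteDimensional ℝ E]

theorem V_comp_inv [CompactSpace G] : V I ∘ (fun x : G => x⁻¹) = V I := by
  have := topologicalGroup_of_lieGroup I ∞ (G := G)
  exact funext (trace_map_inv_of_continuous (contMDiff_adjointRep I).continuous)

theorem mdifferentiable_V : MDifferentiable I 𝓘(ℝ, ℝ) (V I : G → ℝ) :=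
  (traceCLM ℝ E).mdifferentiable.comp ((contMDiff_adjointRep I).mdifferentiable (by simp))

theorem mfderiv_V_conj_eq_zero {x : G} (hx : mfderiv I 𝓘(ℝ, ℝ) (V I) x = 0) (y : G) :
    mfderiv I 𝓘(ℝ, ℝ) (V I) (y * x * y⁻¹) = 0 := by
  refine mfderiv_eq_zero_of_comp_eq (φ := fun z => y⁻¹ * z * y⁻¹⁻¹) (mdifferentiable_V I _)
    ((contMDiff_conj_right I y⁻¹).mdifferentiable (by simp) _) (V_comp_conj I y⁻¹) ?_
  have h : y⁻¹ * (y * x * y⁻¹) * y⁻¹⁻¹ = x := by group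
  rwa [h]

theorem mfderiv_V_inv_eq_zero [CompactSpace G] {x : G} (hx : mfderiv I 𝓘(ℝ, ℝ) (V I) x = 0) :
    mfderiv I 𝓘(ℝ, ℝ) (V I) x⁻¹ = 0 := by
  refine mfderiv_eq_zero_of_comp_eq (mdifferentiable_V I _)
    ((contMDiff_inv I ∞).mdifferentiable (by simp) _) (V_comp_inv I) ?_
  rwa [inv_inv]

/-- The map sending an operator `A` to the linear form `z ↦ tr (A ∘ D z)`. For `D = ad` and
`A = Ad g` this form is the differential of `V` at `g` in the left trivialization, and for
`A = ad v` it is the Killing form paired with `v`. -/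
def tracePairing (D : E →L[ℝ] E →L[ℝ] E) : (E →L[ℝ] E) →L[ℝ] (E →L[ℝ] ℝ) :=
  (ContinuousLinearMap.compL ℝ E (E →L[ℝ] E) ℝ (traceCLM ℝ E)).comp
    (((ContinuousLinearMap.compL ℝ E (E →L[ℝ] E) (E →L[ℝ] E)).flip D).comp
      (ContinuousLinearMap.compL ℝ E E E))

theorem mfderiv_V_mulInvariantVectorField (w : G) (v : GroupLieAlgebra I G) :
    mfderiv I 𝓘(ℝ, ℝ) (V I) w (mulInvariantVectorField v w) =
      tracePairing (ad I G) (adjointRep I w) v := by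
  have hmul : MDifferentiable I I fun z : G => w * z :=
    (contMDiff_mul_left (I := I) (n := ∞)).mdifferentiable (by simp)
  have hV : V I ∘ (fun z => w * z) =
      (traceCLM ℝ E ∘L ContinuousLinearMap.compL ℝ E E E (adjointRep I w)) ∘ adjointRep I := by
    funext z
    simp only [Function.comp_apply, V_eq_trace_adjointRep, map_mul]
    rfl
  have hchain : HasMFDerivAt I 𝓘(ℝ, ℝ) (V I ∘ fun z => w * z) 1
      (tracePairing (ad I G) (adjointRep I w)) := by
    rw [hV]
    exact (ContinuousLinearMap.hasMFDerivAt _).comp (1 : G) (hasMFDerivAt_adjointRep_one I)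
  have h := mfderiv_comp_apply_of_eq (1 : G) (mdifferentiable_V I w) (hmul 1) (mul_one w) v
  rw [hchain.mfderiv] at h
  exact h.symm

variable [I.Boundaryless]

theorem tracePairing_ad_ad (v w : GroupLieAlgebra I G) :
    tracePairing (ad I G) (ad I G v) w = killingForm ℝ (GroupLieAlgebra I G) v w := by
  have had (u : GroupLieAlgebra I G) :
      (ad I G u : E →ₗ[ℝ] E) = LieAlgebra.ad ℝ (GroupLieAlgebra I G) u :=
    LinearMap.ext (ad_apply_apply I u)
  rw [killingForm_apply_apply, ← had, ← had]
  rfl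

theorem injective_tracePairing_comp_ad [LieAlgebra.HasTrivialRadical ℝ (GroupLieAlgebra I G)] :
    Function.Injective (tracePairing (ad I G) ∘L ad I G) := by
  have : Module.Finite ℝ (GroupLieAlgebra I G) := inferInstanceAs (Module.Finite ℝ E)
  refine (injective_iff_map_eq_zero _).2 fun v hv => ?_
  have hker : v ∈ LinearMap.ker (killingForm ℝ (GroupLieAlgebra I G)) :=
    LinearMap.ext fun w => (tracePairing_ad_ad I v w).symm.trans (DFunLike.congr_fun hv w)
  rwa [LieAlgebra.IsKilling.ker_killingForm_eq_bot] at hker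

theorem eventually_eq_one_of_mfderiv_V_eq_zero
    [LieAlgebra.HasTrivialRadical ℝ (GroupLieAlgebra I G)] :
    ∀ᶠ g in 𝓝 (1 : G), mfderiv I 𝓘(ℝ, ℝ) (V I) g = 0 → g = 1 := by
  have hderiv := (tracePairing (ad I G)).hasFDerivAt.comp _
    (hasFDerivAt_adjointRep_extChartAt_symm I (G := G))
  obtain ⟨K, -, hK⟩ := LinearMap.exists_antilipschitzWith _
    (LinearMap.ker_eq_bot.2 (injective_tracePairing_comp_ad I (G := G)))
  have hne := eventually_nhdsWithin_iff.1 (hderiv.eventually_ne ⟨K, hK⟩ (c := 0))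
  filter_upwards [(continuousAt_extChartAt (I := I) (1 : G)).eventually hne,
    extChartAt_source_mem_nhds (I := I) (1 : G)] with g hg hsource hcrit
  by_contra h
  refine hg (fun heq => h ?_) ?_
  · exact (extChartAt I (1 : G)).injOn hsource (mem_extChartAt_source 1) heq
  · rw [Function.comp_apply, (extChartAt I (1 : G)).left_inv hsource]
    ext v
    refine (mfderiv_V_mulInvariantVectorField I g v).symm.trans ?_
    rw [hcrit]
    rfl

end LieTracking

end

theorem mainTheorem9_general
    {E : Type*} [NormedAddCommGroup E] [NormedSpace ℝ E] [FiniteDimensional ℝ E]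
    {H : Type*} [TopologicalSpace H] (I : ModelWithCorners ℝ E H) [I.Boundaryless]
    {G : Type*} [TopologicalSpace G] [ChartedSpace H G] [Group G] [LieGroup I ∞ G]
    [CompactSpace G] {m : ℕ} (X : Fin m → GroupLieAlgebra I G) (xr : ℝ → G)
    (hreg : LieTracking.IsRegularTrajectory I X xr) :
    (∀ x y : G, x ∈ LieTracking.criticalSet I X xr →
      y * x * y⁻¹ ∈ LieTracking.criticalSet I X xr) ∧
    (∀ x y : G, x * y ∈ LieTracking.criticalSet I X xr →
      y * x ∈ LieTracking.criticalSet I X xr) ∧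
    (∀ x : G, x ∈ LieTracking.criticalSet I X xr →
      x⁻¹ ∈ LieTracking.criticalSet I X xr) ∧
    (LieAlgebra.HasTrivialRadical ℝ (GroupLieAlgebra I G) →
      (∃ K : Subgroup G, (K : Set G) = LieTracking.criticalSet I X xr) →
      (LieTracking.criticalSet I X xr).Finite) := by
  simp only [LieTracking.mem_criticalSet_iff I hreg]
  refine ⟨fun x y hx => LieTracking.mfderiv_V_conj_eq_zero I hx y, fun x y hxy => ?_,
    fun x hx => LieTracking.mfderiv_V_inv_eq_zero I hx, ?_⟩
  · have h : y * x = y * (x * y) * y⁻¹ := by group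
    rw [h]
    exact LieTracking.mfderiv_V_conj_eq_zero I hxy y
  · rintro hrad ⟨K, hK⟩
    have := topologicalGroup_of_lieGroup I ∞ (G := G)
    rw [← hK]
    refine subgroup_finite_of_eventually_eq_one ?_
    filter_upwards [LieTracking.eventually_eq_one_of_mfderiv_V_eq_zero I (G := G)] with g hg hgK
    exact hg ((LieTracking.mem_criticalSet_iff I hreg).1 (hK ▸ hgK))

theorem mainTheorem9
    {E : Type*} [NormedAddCommGroup E] [NormedSpace ℝ E] [FiniteDimensional ℝ E]
    {H : Type*} [TopologicalSpace H] (I : ModelWithCorners ℝ E H) [I.Boundaryless]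
    {G : Type*} [TopologicalSpace G] [ChartedSpace H G] [Group G] [LieGroup I ∞ G]
    [T2Space G] [CompactSpace G] [ConnectedSpace G]
    {m : ℕ} (X : Fin m → GroupLieAlgebra I G)
    (hX : LieSubalgebra.lieSpan ℝ (GroupLieAlgebra I G) (Set.range X) = ⊤)
    (xr : ℝ → G) (ur : Fin m → ℝ → ℝ) (T : ℝ)
    (hper : LieTracking.IsPeriodicTrajectory I X xr ur T)
    (hreg : LieTracking.IsRegularTrajectory I X xr) :
    (∀ x y : G, x ∈ LieTracking.criticalSet I X xr →
      y * x * y⁻¹ ∈ LieTracking.criticalSet I X xr) ∧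
    (∀ x y : G, x * y ∈ LieTracking.criticalSet I X xr →
      y * x ∈ LieTracking.criticalSet I X xr) ∧
    (∀ x : G, x ∈ LieTracking.criticalSet I X xr →
      x⁻¹ ∈ LieTracking.criticalSet I X xr) ∧
    (LieAlgebra.HasTrivialRadical ℝ (GroupLieAlgebra I G) →
      (∃ K : Subgroup G, (K : Set G) = LieTracking.criticalSet I X xr) →
      (LieTracking.criticalSet I X xr).Finite) :=
  mainTheorem9_general I X xr hreg
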